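/- Let $\mathbb X,\mathbb Y$ be Hilbert spaces over $\mathbb K\in\{\mathbb R,\mathbb C\}$, let $\Omega\subseteq\mathbb X$ be open, and let $F:\Omega\to\mathbb Y$ be continuously differentiable such that $F'(x)$ has closed image for every $x\in\Omega$. Let $J:\mathbb X\to\mathbb R\cup\{+\infty\}$ be convex, finite at some point of $\Omega$, and lower semicontinuous at every point of $\Omega$ (a functional given only on $\Omega$ is extended by $+\infty$ outside $\Omega$). Write $A^\dagger$ for the Moore–Penrose inverse and $A^*$ for the adjoint of a bounded operator $A$, $B(a,\rho)$ for the open ball, $$\partial J(x)=\{v\in\mathbb X:\ J(x)<+\infty,\ J(y)\ge J(x)+\operatorname{Re}\langle v,y-x\rangle\ \text{for all } y\in\mathbb X\},$$ $H(x):=F'(x)^*F'(x)$, and, for a bounded, positive, selfadjoint operator $H$ on $\mathbb X$ that is bounded from below (i.e. $\langle v,Hv\rangle\ge m\|v\|^2$ for some $m>0$ and all $v$), $$\operatorname{prox}_J^{H}(z):=\operatorname*{argmin}_{x\in\mathbb X}\Big\{J(x)+\tfrac12\langle x-z,H(x-z)\rangle\Big\}.$$ Let $x_*\in\Omega$, $R>0$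 and $$c:=\|F(x_*)\|,\qquad \beta:=\|F'(x_*)^\dagger\|,\qquad \kappa:=\beta\|F'(x_*)\|,\qquad \delta:=\sup\{t\in[0,R): B(x_*,t)\subset\Omega\}.$$ Suppose that $-F'(x_*)^*F(x_*)\in\partial J(x_*)$, that $F'(x_*)$ is injective, and that there is $L>0$ such that $$h:=[(1+\sqrt2)\kappa+1]\,c\,\beta L<1,\qquad \beta\|F'(x)-F'(x_*+\tau(x-x_*))\|\le L(1-\tau)\|x-x_*\|$$ for all $x\in B(x_*,\delta)$ and $\tau\in[0,1]$. Let $$r:=\min\left\{\frac{4+\kappa+2c(1+\sqrt2)\beta L-\sqrt{(4+\kappa+2c(1+\sqrt2)\beta L)^2-8(1-h)}}{2L},\ \delta\right\}.$$ Then, for every starting point $x_0\in B(x_*,r)\setminus\{x_*\}$, the proximal Gauss–Newton method $$x_{k+1}=\operatorname{prox}_J^{H(x_k)}\big(x_k-F'(x_k)^\dagger F(x_k)\big),\qquad k=0,1,\dots,$$ is well defined (for every $k$: $x_k\in\Omega$, $F'(x_k)$ is injective and has a Moore–Penrose inverse, $H(x_k)$ is positive, selfadjoint and bounded from below, and the minimization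 problem defining $x_{k+1}$ has exactly one solution), the sequence $(x_k)$ is contained in $B(x_*,r)$ and converges to $x_*$, and, for all $k=0,1,\dots$, $$\|x_{k+1}-x_*\|\le\frac{\kappa L+2c(1+\sqrt2)\beta L^2+L^2\|x_0-x_*\|}{2[1-L\|x_0-x_*\|]^2}\,\|x_k-x_*\|^2+\frac{[(1+\sqrt2)\kappa+1]\,c\,\beta L}{[1-L\|x_0-x_*\|]^2}\,\|x_k-x_*\|.$$ -/

import Mathlib

open Set Filter Topology

namespace ProxGN

variable {𝕜 : Type*} [RCLike 𝕜]
  {X : Type*} [NormedAddCommGroup X] [InnerProductSpace 𝕜 X] [CompleteSpace X]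
  {Y : Type*} [NormedAddCommGroup Y] [InnerProductSpace 𝕜 Y] [CompleteSpace Y]

/-- The four Penrose equations: `B` is a Moore-Penrose inverse of `A`. -/
structure IsMoorePenrose (A : X →L[𝕜] Y) (B : Y →L[𝕜] X) : Prop where
  mul_mul_left : A ∘L B ∘L A = A
  mul_mul_right : B ∘L A ∘L B = B
  selfAdjoint_left : ContinuousLinearMap.adjoint (A ∘L B) = A ∘L B
  selfAdjoint_right : ContinuousLinearMap.adjoint (B ∘L A) = B ∘L A

/-- The Moore-Penrose inverse is unique. -/
theorem IsMoorePenrose.unique {A : X →L[𝕜] Y} {B C : Y →L[𝕜] X}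
    (hB : IsMoorePenrose A B) (hC : IsMoorePenrose A C) : B = C := by
  have h1 : A ∘L B = A ∘L C := by
    calc A ∘L B = ContinuousLinearMap.adjoint (A ∘L B) := hB.selfAdjoint_left.symm
      _ = ContinuousLinearMap.adjoint ((A ∘L C) ∘L (A ∘L B)) := by
          congr 1
          conv_lhs => rw [← hC.mul_mul_left]
          rfl
      _ = (A ∘L B) ∘L (A ∘L C) := by
          rw [ContinuousLinearMap.adjoint_comp, hB.selfAdjoint_left, hC.selfAdjoint_left]
      _ = (A ∘L B ∘L A) ∘L C := rfl
      _ = A ∘L C := by rw [hB.mul_mul_left]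
  have h2 : B ∘L A = C ∘L A := by
    calc B ∘L A = ContinuousLinearMap.adjoint (B ∘L A) := hB.selfAdjoint_right.symm
      _ = ContinuousLinearMap.adjoint ((B ∘L A) ∘L (C ∘L A)) := by
          congr 1
          conv_lhs => rw [← hC.mul_mul_left]
          rfl
      _ = (C ∘L A) ∘L (B ∘L A) := by
          rw [ContinuousLinearMap.adjoint_comp, hB.selfAdjoint_right, hC.selfAdjoint_right]
      _ = C ∘L (A ∘L B ∘L A) := rfl
      _ = C ∘L A := by rw [hB.mul_mul_left]
  calc B = B ∘L A ∘L B := hB.mul_mul_right.symm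
    _ = B ∘L (A ∘L C) := by rw [h1]
    _ = (B ∘L A) ∘L C := rfl
    _ = C ∘L A ∘L C := by rw [h2]; rfl
    _ = C := hC.mul_mul_right

open Classical in
/-- The Moore-Penrose inverse of `A` (with the value `0` if there is none, which does not
happen for an operator with closed range). -/
noncomputable def pinv (A : X →L[𝕜] Y) : Y →L[𝕜] X :=
  if h : ∃ B, IsMoorePenrose A B then h.choose else 0

/-- Properness of an extended-real-valued functional: it never takes the value `-∞` and it is
finite somewhere on `Ω`. -/
def IsProper (J : X → EReal) (Ω : Set X) : Prop :=
  (∀ x, J x ≠ ⊥) ∧ ∃ x ∈ Ω, J x ≠ ⊤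

variable (𝕜) in
/-- Convexity of a functional with values in `ℝ ∪ {+∞}`. The scalars are real; they are
coerced into `𝕜` (which is `ℝ` or `ℂ`). -/
def IsConvexFunctional (J : X → EReal) : Prop :=
  ∀ x y : X, ∀ a b : ℝ, 0 < a → 0 < b → a + b = 1 →
    J ((a : 𝕜) • x + (b : 𝕜) • y) ≤ (a : EReal) * J x + (b : EReal) * J y

variable (𝕜) in
/-- The subdifferential `∂J(x)` of convex analysis, for the real inner product `Re ⟪·,·⟫`. -/
def subdiff (J : X → EReal) (x : X) : Set X :=
  {v | J x ≠ ⊤ ∧ ∀ y, J x + ((RCLike.re (inner 𝕜 v (y - x)) : ℝ) : EReal) ≤ J y}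

/-- `H` defines an equivalent inner product on `X`: it is positive, selfadjoint and bounded from
below. -/
def IsMetricOperator (H : X →L[𝕜] X) : Prop :=
  H.IsPositive ∧ ∃ m : ℝ, 0 < m ∧ ∀ v, m * ‖v‖ ^ 2 ≤ RCLike.re (inner 𝕜 v (H v))

/-- The functional `x ↦ J(x) + ½‖x - z‖_H²`, where `‖v‖_H² = ⟪v, H v⟫`. -/
noncomputable def proxObjective (J : X → EReal) (H : X →L[𝕜] X) (z x : X) : EReal :=
  J x + ((1 / 2 * RCLike.re (inner 𝕜 (x - z) (H (x - z))) : ℝ) : EReal)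

/-- `p` minimizes `x ↦ J(x) + ½‖x - z‖_H²` over `X`. -/
def IsProx (J : X → EReal) (H : X →L[𝕜] X) (z p : X) : Prop :=
  ∀ x, proxObjective J H z p ≤ proxObjective J H z x

open Classical in
/-- The proximity operator `prox_J^H`: the minimizer of `x ↦ J(x) + ½‖x - z‖_H²` (with the value
`z` if there is no minimizer). -/
noncomputable def prox (J : X → EReal) (H : X →L[𝕜] X) (z : X) : X :=
  if h : ∃ p, IsProx J H z p then h.choose else z

variable (𝕜) in
/-- `H(x) = F'(x)* F'(x)`. -/
noncomputable def gnMetric (F : X → Y) (x : X) : X →L[𝕜] X :=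
  ContinuousLinearMap.adjoint (fderiv 𝕜 F x) ∘L fderiv 𝕜 F x

variable (𝕜) in
/-- The Gauss-Newton point `x - F'(x)† F(x)`. -/
noncomputable def gnPoint (F : X → Y) (x : X) : X :=
  x - pinv (fderiv 𝕜 F x) (F x)

variable (𝕜) in
/-- The sequence of the proximal Gauss-Newton method with starting point `x₀`:
`x_{k+1} = prox_J^{H(x_k)} (x_k - F'(x_k)† F(x_k))`. -/
noncomputable def proxGaussNewton (F : X → Y) (J : X → EReal) (x₀ : X) : ℕ → X
  | 0 => x₀
  | k + 1 =>
      prox J (gnMetric 𝕜 F (proxGaussNewton F J x₀ k)) (gnPoint 𝕜 F (proxGaussNewton F J x₀ k))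

variable (𝕜) in
/-- The proximal Gauss-Newton step from `x` is well defined: `x` lies in the domain `Ω` of `F`,
`F` is differentiable there, `F'(x)` is injective and has a Moore-Penrose inverse,
`H(x)` defines an equivalent inner product, and the minimization problem that defines the next
iterate has exactly one solution. -/
structure StepWellDefined (F : X → Y) (J : X → EReal) (Ω : Set X) (x : X) : Prop where
  mem : x ∈ Ω
  differentiable : DifferentiableAt 𝕜 F x
  injective : Function.Injective (fderiv 𝕜 F x)
  exists_pinv : ∃ B, IsMoorePenrose (fderiv 𝕜 F x) B
  metric : IsMetricOperator (gnMetric 𝕜 F x)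
  existsUnique_prox : ∃! p, IsProx J (gnMetric 𝕜 F x) (gnPoint 𝕜 F x) p

end ProxGN

namespace ProxGN

variable {𝕜 : Type*} [RCLike 𝕜]
  {X : Type*} [NormedAddCommGroup X] [InnerProductSpace 𝕜 X]
  {Y : Type*} [NormedAddCommGroup Y] [InnerProductSpace 𝕜 Y]

/-! Everything rests on a one-step estimate. Let A = F'(x), ρ = ‖x - x_*‖, let z be the Gauss–Newton
point and p the next iterate. Strong convexity of the prox objective at p, combined with the
subgradient -F'(x_*)^*F(x_*) at x_*, bounds ‖A(p - x_*)‖² by inner products. The identity A^*AA^† =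
A^* removes the pseudoinverse from them, leaving the Taylor remainder of F between x_* and x, tested
against A(p - x_*), and F(x_*) tested against (A - F'(x_*))(p - x_*). The radial Lipschitz condition
controls both, and the perturbed lower bound ‖v‖ ≤ β/(1 - Lρ)‖Av‖ turns the result into ‖p - x_*‖ ≤
Lρ²/(2(1 - Lρ)) + cβLρ/(1 - Lρ)². This is below the claimed bound because κ ≥ 1, and r is chosen so
that the claimed bound contracts.

Existence of p is delicate, since J is lower semicontinuous only on Ω while the minimization runs
over X. Minimizing sequences are Cauchy, and their limit satisfies the estimate without any
semicontinuity (`exists_generalized_prox`). The estimate puts the limit in Ω, where semicontinuity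
makes it a minimizer (`proxGaussNewton_step`). -/

/-! ### Moore–Penrose inverses. -/

/-- An injective operator with closed range has a Moore-Penrose inverse. -/
theorem exists_isMoorePenrose [CompleteSpace X] [CompleteSpace Y] (A : X →L[𝕜] Y)
    (hinj : Function.Injective A)
    (hclo : IsClosed (Set.range A)) : ∃ B, IsMoorePenrose A B := by
  have hcl : IsClosed (A.range : Set Y) := hclo
  have : CompleteSpace A.range := hcl.completeSpace_coe
  let e : X ≃L[𝕜] A.range := A.equivRange hinj hclo
  have he : ∀ x, (e x : Y) = A x := fun x => rfl
  let B : Y →L[𝕜] X := (e.symm : A.range →L[𝕜] X) ∘L A.range.orthogonalProjectionOnto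
  have hAB : A ∘L B = A.range.starProjection := by
    ext y
    change A (e.symm (A.range.orthogonalProjectionOnto y)) = _
    rw [← he, ContinuousLinearEquiv.apply_symm_apply]
    rfl
  have hBA : B ∘L A = ContinuousLinearMap.id 𝕜 X := by
    ext x
    change e.symm (A.range.orthogonalProjectionOnto (A x)) = x
    rw [ContinuousLinearEquiv.symm_apply_eq, ← he x,
      Submodule.orthogonalProjectionOnto_mem_subspace_eq_self]
  refine ⟨B, ?_, ?_, ?_, ?_⟩
  · rw [hBA]; rfl
  · rw [← ContinuousLinearMap.comp_assoc, hBA]; rfl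
  · rw [hAB]
    exact (ContinuousLinearMap.isSelfAdjoint_iff'.1 (isSelfAdjoint_starProjection _))
  · rw [hBA]
    exact (ContinuousLinearMap.isSelfAdjoint_iff'.1 (IsSelfAdjoint.one _))

theorem pinv_isMoorePenrose [CompleteSpace X] [CompleteSpace Y] {A : X →L[𝕜] Y}
    (h : ∃ B, IsMoorePenrose A B) : IsMoorePenrose A (pinv A) := by
  rw [pinv, dif_pos h]
  exact h.choose_spec

theorem IsMoorePenrose.apply_apply_of_injective [CompleteSpace X] [CompleteSpace Y]
    {A : X →L[𝕜] Y} {B : Y →L[𝕜] X} (h : IsMoorePenrose A B) (hinj : Function.Injective A)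
    (x : X) : B (A x) = x :=
  hinj (DFunLike.congr_fun h.mul_mul_left x)

/-- Adjoint of ABA = A, with AB selfadjoint. It eliminates the pseudoinverse from the step estimate.
-/
theorem IsMoorePenrose.adjoint_apply_apply [CompleteSpace X] [CompleteSpace Y]
    {A : X →L[𝕜] Y} {B : Y →L[𝕜] X} (h : IsMoorePenrose A B) (y : Y) :
    ContinuousLinearMap.adjoint A (A (B y)) = ContinuousLinearMap.adjoint A y := by
  have h1 := congrArg ContinuousLinearMap.adjoint h.mul_mul_left
  rw [← ContinuousLinearMap.comp_assoc, ContinuousLinearMap.adjoint_comp, h.selfAdjoint_left] at h1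
  exact DFunLike.congr_fun h1 y

/-- The Stewart identity for the squared norm of a convex combination. -/
theorem norm_sq_convex_combination (u w : Y) (a b : ℝ) (hab : a + b = 1) :
    ‖(a : 𝕜) • u + (b : 𝕜) • w‖ ^ 2 = a * ‖u‖ ^ 2 + b * ‖w‖ ^ 2 - a * b * ‖u - w‖ ^ 2 := by
  have hb : b = 1 - a := by linarith
  rw [@norm_add_sq 𝕜, @norm_sub_sq 𝕜, inner_smul_left, inner_smul_right, norm_smul, norm_smul]
  simp only [RCLike.conj_ofReal, RCLike.re_ofReal_mul, RCLike.norm_ofReal, mul_pow, sq_abs]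
  subst hb
  ring

/-! ### Existence and uniqueness of proximal points. -/

section Prox

variable {J : X → EReal}

theorem IsConvexFunctional.ne_top (hJ : IsConvexFunctional 𝕜 J) {x y : X}
    (hx : J x ≠ ⊤) (hy : J y ≠ ⊤) (hbot : ∀ x, J x ≠ ⊥) {a b : ℝ} (ha : 0 < a) (hb : 0 < b)
    (hab : a + b = 1) : J ((a : 𝕜) • x + (b : 𝕜) • y) ≠ ⊤ := by
  have h := hJ x y a b ha hb hab
  rw [← EReal.coe_toReal hx (hbot x), ← EReal.coe_toReal hy (hbot y)] at h
  exact ne_top_of_le_ne_top (EReal.coe_ne_top _) (by exact_mod_cast h)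

theorem IsConvexFunctional.toReal_le (hJ : IsConvexFunctional 𝕜 J) {x y : X}
    (hx : J x ≠ ⊤) (hy : J y ≠ ⊤) (hbot : ∀ x, J x ≠ ⊥) {a b : ℝ} (ha : 0 < a) (hb : 0 < b)
    (hab : a + b = 1) :
    (J ((a : 𝕜) • x + (b : 𝕜) • y)).toReal ≤ a * (J x).toReal + b * (J y).toReal := by
  have h := hJ x y a b ha hb hab
  rw [← EReal.coe_toReal hx (hbot x), ← EReal.coe_toReal hy (hbot y),
    ← EReal.coe_toReal (hJ.ne_top hx hy hbot ha hb hab) (hbot _)] at h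
  exact_mod_cast h

/-- The real-valued prox objective on the effective domain of `J`, for the metric `A* A`. -/
noncomputable def realObjective (J : X → EReal) (A : X →L[𝕜] Y) (z x : X) : ℝ :=
  (J x).toReal + 1 / 2 * ‖A (x - z)‖ ^ 2

theorem proxObjective_eq [CompleteSpace X] [CompleteSpace Y] (J : X → EReal) (A : X →L[𝕜] Y)
    (z x : X) :
    proxObjective J (ContinuousLinearMap.adjoint A ∘L A) z x
      = J x + ((1 / 2 * ‖A (x - z)‖ ^ 2 : ℝ) : EReal) := by
  rw [proxObjective, ContinuousLinearMap.comp_apply, ContinuousLinearMap.adjoint_inner_right,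
    inner_self_eq_norm_sq]

theorem proxObjective_eq_coe [CompleteSpace X] [CompleteSpace Y] {A : X →L[𝕜] Y} {z x : X}
    (hx : J x ≠ ⊤) (hbot : ∀ x, J x ≠ ⊥) :
    proxObjective J (ContinuousLinearMap.adjoint A ∘L A) z x = (realObjective J A z x : ℝ) := by
  rw [proxObjective_eq, realObjective, EReal.coe_add, EReal.coe_toReal hx (hbot x)]

theorem isProx_iff [CompleteSpace X] [CompleteSpace Y] {A : X →L[𝕜] Y} {z p x₁ : X}
    (hbot : ∀ x, J x ≠ ⊥) (hx₁ : J x₁ ≠ ⊤) :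
    IsProx J (ContinuousLinearMap.adjoint A ∘L A) z p ↔
      J p ≠ ⊤ ∧ ∀ x, J x ≠ ⊤ → realObjective J A z p ≤ realObjective J A z x := by
  constructor
  · intro h
    have hp : J p ≠ ⊤ := by
      intro hp
      have h1 := h x₁
      rw [proxObjective_eq_coe hx₁ hbot, proxObjective_eq, hp,
        EReal.top_add_coe] at h1
      exact EReal.coe_ne_top _ (top_le_iff.1 h1)
    refine ⟨hp, fun x hx => ?_⟩
    have h1 := h x
    rw [proxObjective_eq_coe hx hbot, proxObjective_eq_coe hp hbot] at h1
    exact_mod_cast h1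
  · rintro ⟨hp, h⟩ x
    by_cases hx : J x = ⊤
    · rw [proxObjective_eq J A z x, hx, EReal.top_add_coe]
      exact le_top
    · rw [proxObjective_eq_coe hx hbot, proxObjective_eq_coe hp hbot]
      exact_mod_cast h x hx

/-- Strong convexity of the prox objective along segments. -/
theorem realObjective_convex_combination_le (hJ : IsConvexFunctional 𝕜 J) (hbot : ∀ x, J x ≠ ⊥)
    (A : X →L[𝕜] Y) (z : X) {x y : X} (hx : J x ≠ ⊤) (hy : J y ≠ ⊤) {a b : ℝ} (ha : 0 < a)
    (hb : 0 < b) (hab : a + b = 1) :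
    realObjective J A z ((a : 𝕜) • x + (b : 𝕜) • y) ≤
      a * realObjective J A z x + b * realObjective J A z y
        - a * b / 2 * ‖A (x - y)‖ ^ 2 := by
  have h1 := hJ.toReal_le hx hy hbot ha hb hab
  have hz : (a : 𝕜) • x + (b : 𝕜) • y - z = (a : 𝕜) • (x - z) + (b : 𝕜) • (y - z) := by
    have : (a : 𝕜) + b = 1 := by exact_mod_cast hab
    have h2 : z = (a : 𝕜) • z + (b : 𝕜) • z := by rw [← add_smul, this, one_smul]
    rw [smul_sub, smul_sub]
    nth_rw 1 [h2]
    abel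
  have h2 := norm_sq_convex_combination (𝕜 := 𝕜) (A (x - z)) (A (y - z)) a b hab
  rw [← map_smul, ← map_smul, ← map_add, ← hz, ← map_sub, sub_sub_sub_cancel_right] at h2
  simp only [realObjective]
  rw [h2]
  linarith

/-- At the midpoint of two minimizers, strong convexity would beat the minimum unless A(p - q) = 0.
-/
theorem isProx_unique [CompleteSpace X] [CompleteSpace Y] (hJ : IsConvexFunctional 𝕜 J)
    (hbot : ∀ x, J x ≠ ⊥) {A : X →L[𝕜] Y} (hinj : Function.Injective A) {z x₁ p q : X}
    (hx₁ : J x₁ ≠ ⊤) (hp : IsProx J (ContinuousLinearMap.adjoint A ∘L A) z p)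
    (hq : IsProx J (ContinuousLinearMap.adjoint A ∘L A) z q) : p = q := by
  rw [isProx_iff hbot hx₁] at hp hq
  have half : (0 : ℝ) < 1 / 2 := by norm_num
  have h1 := realObjective_convex_combination_le hJ hbot A z hp.1 hq.1 half half (by norm_num)
  have h2 := hp.2 _ (hJ.ne_top hp.1 hq.1 hbot half half (by norm_num))
  have h3 := hq.2 _ hp.1
  have h4 : ‖A (p - q)‖ ^ 2 ≤ 0 := by linarith
  have h5 : A (p - q) = 0 := norm_eq_zero.1 (pow_eq_zero_iff two_ne_zero |>.1
    (le_antisymm h4 (sq_nonneg _)))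
  exact sub_eq_zero.1 (hinj (h5.trans (map_zero A).symm))

theorem toReal_ge_of_mem_subdiff {x₁ v : X} (hv : v ∈ subdiff 𝕜 J x₁) (hbot : ∀ x, J x ≠ ⊥)
    {y : X} (hy : J y ≠ ⊤) :
    (J x₁).toReal + RCLike.re (inner 𝕜 v (y - x₁)) ≤ (J y).toReal := by
  have h := hv.2 y
  rw [← EReal.coe_toReal hv.1 (hbot x₁), ← EReal.coe_toReal hy (hbot y)] at h
  exact_mod_cast h

/-- The minimizing sequences of the prox objective converge to a point `p` that is comparable with
every point having a subgradient, and that minimizes as soon as `J` is lower semicontinuous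
at `p`. -/
theorem exists_generalized_prox [CompleteSpace X] [CompleteSpace Y]
    (hJ : IsConvexFunctional 𝕜 J) (hbot : ∀ x, J x ≠ ⊥) {A : X →L[𝕜] Y} {K : ℝ}
    (hK : ∀ v, ‖v‖ ≤ K * ‖A v‖) {x₁ v : X} (hv : v ∈ subdiff 𝕜 J x₁) (z : X) :
    ∃ p, ‖A (p - x₁)‖ ^ 2 ≤
        RCLike.re (inner 𝕜 (A (z - x₁)) (A (p - x₁))) - RCLike.re (inner 𝕜 v (p - x₁)) ∧
      (LowerSemicontinuousAt J p → IsProx J (ContinuousLinearMap.adjoint A ∘L A) z p) := by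
  set Φ := realObjective J A z with hΦ
  set D : Set X := {x | J x ≠ ⊤} with hD
  have hx₁ : x₁ ∈ D := hv.1
  have hlow : ∀ x ∈ D, (J x₁).toReal + RCLike.re (inner 𝕜 v (x - x₁))
      + 1 / 2 * ‖A (x - z)‖ ^ 2 ≤ Φ x := fun x hx =>
    add_le_add_left (toReal_ge_of_mem_subdiff hv hbot hx) _
  have hbdd : BddBelow (Φ '' D) := by
    -- The last term is the minimum of t²/2 - ‖v‖Kt, with t = ‖A(x - z)‖.
    refine ⟨(J x₁).toReal - ‖v‖ * ‖z - x₁‖ - 1 / 2 * (‖v‖ * K) ^ 2, ?_⟩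
    rintro _ ⟨x, hx, rfl⟩
    have h1 := hlow x hx
    have h2 : -(‖v‖ * ‖x - x₁‖) ≤ RCLike.re (inner 𝕜 v (x - x₁)) :=
      (abs_le.1 ((RCLike.abs_re_le_norm _).trans (norm_inner_le_norm _ _))).1
    have h3 : ‖x - x₁‖ ≤ K * ‖A (x - z)‖ + ‖z - x₁‖ := by
      calc ‖x - x₁‖ = ‖(x - z) + (z - x₁)‖ := by congr 1; abel
        _ ≤ _ := (norm_add_le _ _).trans (by gcongr; exact hK _)
    have h4 := mul_le_mul_of_nonneg_left h3 (norm_nonneg v)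
    nlinarith [sq_nonneg (‖v‖ * K - ‖A (x - z)‖)]
  have hne : (Φ '' D).Nonempty := ⟨_, x₁, hx₁, rfl⟩
  set m := sInf (Φ '' D) with hm
  have hmle : ∀ x ∈ D, m ≤ Φ x := fun x hx => csInf_le hbdd ⟨x, hx, rfl⟩
  have hex : ∀ n : ℕ, ∃ x ∈ D, Φ x < m + 1 / ((n : ℝ) + 1) := by
    intro n
    obtain ⟨_, ⟨x, hx, rfl⟩, hlt⟩ := exists_lt_of_csInf_lt hne
      (show sInf (Φ '' D) < m + 1 / ((n : ℝ) + 1) by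
        have : (0 : ℝ) < 1 / ((n : ℝ) + 1) := by positivity
        linarith)
    exact ⟨x, hx, hlt⟩
  choose u huD hu using hex
  have hε : Tendsto (fun n : ℕ => 1 / ((n : ℝ) + 1)) atTop (𝓝 0) :=
    tendsto_one_div_add_atTop_nhds_zero_nat
  have hΦu : Tendsto (fun n => Φ (u n)) atTop (𝓝 m) := by
    refine tendsto_of_tendsto_of_tendsto_of_le_of_le tendsto_const_nhds ?_
      (fun n => hmle _ (huD n)) (fun n => (hu n).le)
    simpa using tendsto_const_nhds.add hε
  have hsc : ∀ x ∈ D, ∀ y ∈ D, ∀ a b : ℝ, 0 < a → 0 < b → a + b = 1 →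
      m ≤ a * Φ x + b * Φ y - a * b / 2 * ‖A (x - y)‖ ^ 2 := fun x hx y hy a b ha hb hab =>
    (hmle _ (hJ.ne_top hx hy hbot ha hb hab)).trans
      (realObjective_convex_combination_le hJ hbot A z hx hy ha hb hab)
  have hcau : CauchySeq u := by
    have hK' : ∀ k l, ‖u k - u l‖ ^ 2 ≤ K ^ 2 * (4 * ((Φ (u k) - m) + (Φ (u l) - m))) := by
      intro k l
      have h1 := hsc _ (huD k) _ (huD l) (1 / 2) (1 / 2) (by norm_num) (by norm_num) (by norm_num)
      calc ‖u k - u l‖ ^ 2 ≤ (K * ‖A (u k - u l)‖) ^ 2 := by gcongr; exact hK _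
        _ = K ^ 2 * ‖A (u k - u l)‖ ^ 2 := by ring
        _ ≤ _ := by gcongr; linarith
    refine cauchySeq_of_le_tendsto_0
      (fun N : ℕ => Real.sqrt (K ^ 2 * (4 * (1 / ((N : ℝ) + 1) + 1 / ((N : ℝ) + 1))))) ?_ ?_
    · intro k l N hk hl
      rw [dist_eq_norm]
      refine Real.le_sqrt_of_sq_le ((hK' k l).trans ?_)
      have h1 : ∀ k, N ≤ k → Φ (u k) - m ≤ 1 / ((N : ℝ) + 1) := by
        intro k hk
        have h2 : 1 / ((k : ℝ) + 1) ≤ 1 / ((N : ℝ) + 1) := by gcongr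
        linarith [hu k]
      gcongr
      · exact h1 k hk
      · exact h1 l hl
    · have h1 := (((hε.add hε).const_mul 4).const_mul (K ^ 2)).sqrt
      simpa using h1
  obtain ⟨p, hp⟩ := cauchySeq_tendsto_of_complete hcau
  have hA : ∀ w, Tendsto (fun n => ‖A (u n - w)‖ ^ 2) atTop (𝓝 (‖A (p - w)‖ ^ 2)) := fun w =>
    (((A.continuous.tendsto _).comp (hp.sub_const w)).norm).pow 2
  -- Quadratic growth at the limit: strong convexity between u n and x₁, then n → ∞, division by the
  -- weight b of x₁, and b → 0. J is never evaluated at p.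
  have hupper : m + 1 / 2 * ‖A (p - x₁)‖ ^ 2 ≤ Φ x₁ := by
    have h1 : ∀ b ∈ Ioo (0 : ℝ) 1, m + (1 - b) / 2 * ‖A (p - x₁)‖ ^ 2 ≤ Φ x₁ := by
      intro b hb
      have h2 : m ≤ (1 - b) * m + b * Φ x₁ - (1 - b) * b / 2 * ‖A (p - x₁)‖ ^ 2 := by
        refine ge_of_tendsto (((hΦu.const_mul (1 - b)).add_const _).sub ((hA x₁).const_mul _))
          (Eventually.of_forall fun n => ?_)
        exact hsc _ (huD n) _ hx₁ (1 - b) b (by linarith [hb.2]) hb.1 (by ring)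
      refine le_of_mul_le_mul_left ?_ hb.1
      linarith
    have h2 : Tendsto (fun b : ℝ => m + (1 - b) / 2 * ‖A (p - x₁)‖ ^ 2) (𝓝[>] 0)
        (𝓝 (m + (1 - 0) / 2 * ‖A (p - x₁)‖ ^ 2)) :=
      (Continuous.tendsto (by fun_prop) 0).mono_left nhdsWithin_le_nhds
    rw [sub_zero] at h2
    exact le_of_tendsto h2 (by filter_upwards [Ioo_mem_nhdsGT one_pos] with b hb using h1 b hb)
  -- The subgradient minorant is continuous, so it passes to the limit where J itself might not.
  have hlower : (J x₁).toReal + RCLike.re (inner 𝕜 v (p - x₁)) + 1 / 2 * ‖A (p - z)‖ ^ 2 ≤ m := by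
    refine le_of_tendsto_of_tendsto' ((Tendsto.const_add _ ?_).add ((hA z).const_mul _)) hΦu
      (fun n => hlow _ (huD n))
    exact (RCLike.continuous_re.tendsto _).comp (tendsto_const_nhds.inner (hp.sub_const x₁))
  refine ⟨p, ?_, fun hlsc => ?_⟩
  · have h1 : ‖A (p - z)‖ ^ 2 = ‖A (p - x₁)‖ ^ 2
        - 2 * RCLike.re (inner 𝕜 (A (z - x₁)) (A (p - x₁))) + ‖A (x₁ - z)‖ ^ 2 := by
      have h2 : A (p - z) = A (p - x₁) - A (z - x₁) := by rw [← map_sub]; congr 1; abel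
      have h3 : ‖A (x₁ - z)‖ = ‖A (z - x₁)‖ := by rw [← norm_neg, ← map_neg, neg_sub]
      rw [h2, @norm_sub_sq 𝕜, inner_re_symm, h3]
    have h2 : Φ x₁ = (J x₁).toReal + 1 / 2 * ‖A (x₁ - z)‖ ^ 2 := rfl
    linarith
  · have hJp : J p ≤ ((m - 1 / 2 * ‖A (p - z)‖ ^ 2 : ℝ) : EReal) := by
      by_contra! hlt
      obtain ⟨t, ht1, ht2⟩ := EReal.lt_iff_exists_real_btwn.1 hlt
      have h1 : Tendsto (fun n => Φ (u n) - 1 / 2 * ‖A (u n - z)‖ ^ 2) atTop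
          (𝓝 (m - 1 / 2 * ‖A (p - z)‖ ^ 2)) := hΦu.sub ((hA z).const_mul _)
      obtain ⟨n, hn1, hn2⟩ := ((hp.eventually (hlsc t ht2)).and
        (h1.eventually_lt_const (EReal.coe_lt_coe_iff.1 ht1))).exists
      rw [← EReal.coe_toReal (huD n) (hbot _), gt_iff_lt, EReal.coe_lt_coe_iff] at hn1
      have h2 : Φ (u n) = (J (u n)).toReal + 1 / 2 * ‖A (u n - z)‖ ^ 2 := rfl
      linarith
    have hpD : J p ≠ ⊤ := ne_top_of_le_ne_top (EReal.coe_ne_top _) hJp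
    rw [isProx_iff hbot hv.1]
    refine ⟨hpD, fun x hx => le_trans ?_ (hmle x hx)⟩
    rw [← EReal.coe_toReal hpD (hbot _), EReal.coe_le_coe_iff] at hJp
    simp only [realObjective]
    linarith

end Prox

/-! ### Taylor remainder under a radial Lipschitz condition. -/

/-- The first order Taylor estimate for a derivative that satisfies a radial Lipschitz condition
towards `x`. -/
theorem norm_taylor_le {F : X → Y} {x₁ x : X} {M : ℝ}
    (hd : ∀ τ ∈ Icc (0 : ℝ) 1, DifferentiableAt 𝕜 F (x₁ + (τ : 𝕜) • (x - x₁)))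
    (hlip : ∀ τ ∈ Icc (0 : ℝ) 1,
      ‖fderiv 𝕜 F x - fderiv 𝕜 F (x₁ + (τ : 𝕜) • (x - x₁))‖ ≤ M * (1 - τ)) :
    ‖fderiv 𝕜 F x (x - x₁) - F x + F x₁‖ ≤ M / 2 * ‖x - x₁‖ := by
  let _ : NormedSpace ℝ Y := NormedSpace.restrictScalars ℝ 𝕜 Y
  have : IsScalarTower ℝ 𝕜 Y := RestrictScalars.isScalarTower ℝ 𝕜 Y
  set d := x - x₁ with hdd
  set f : ℝ → Y := fun τ => (τ : 𝕜) • fderiv 𝕜 F x d - F (x₁ + (τ : 𝕜) • d) + F x₁ with hf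
  have hderiv : ∀ τ ∈ Icc (0 : ℝ) 1,
      HasDerivAt f (fderiv 𝕜 F x d - fderiv 𝕜 F (x₁ + (τ : 𝕜) • d) d) τ := by
    intro τ hτ
    have h1 : HasDerivAt (fun s : 𝕜 => s • fderiv 𝕜 F x d - F (x₁ + s • d) + F x₁)
        (fderiv 𝕜 F x d - fderiv 𝕜 F (x₁ + (τ : 𝕜) • d) d) (τ : 𝕜) := by
      have h2 : HasDerivAt (fun s : 𝕜 => x₁ + s • d) d (τ : 𝕜) := by
        simpa using ((hasDerivAt_id (τ : 𝕜)).smul_const d).const_add x₁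
      have h3 := (hd τ hτ).hasFDerivAt.comp_hasDerivAt (τ : 𝕜) h2
      have h4 : HasDerivAt (fun s : 𝕜 => s • fderiv 𝕜 F x d) (fderiv 𝕜 F x d) (τ : 𝕜) := by
        simpa using (hasDerivAt_id (τ : 𝕜)).smul_const (fderiv 𝕜 F x d)
      exact (h4.sub h3).add_const _
    have h5 : HasDerivAt (fun s : ℝ => (s : 𝕜)) 1 τ := by
      simpa using (RCLike.ofRealCLM (K := 𝕜)).hasDerivAt (x := τ)
    have h6 := HasDerivAt.scomp τ h1 h5
    rwa [one_smul] at h6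
  have h0 : f 0 = 0 := by simp [hf]
  have h1 : f 1 = fderiv 𝕜 F x d - F x + F x₁ := by simp [hf, hdd]
  have key := image_norm_le_of_norm_deriv_right_le_deriv_boundary (a := 0) (b := 1) (f := f)
    (f' := fun τ => fderiv 𝕜 F x d - fderiv 𝕜 F (x₁ + (τ : 𝕜) • d) d)
    -- The primitive of M‖d‖(1 - τ) vanishing at 0; its value at 1 supplies the factor 1/2.
    (B := fun τ => M * ‖d‖ * (τ - τ ^ 2 / 2)) (B' := fun τ => M * ‖d‖ * (1 - τ))
    (fun τ hτ => (hderiv τ hτ).continuousAt.continuousWithinAt)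
    (fun τ hτ => (hderiv τ ⟨hτ.1, hτ.2.le⟩).hasDerivWithinAt) (by simp [h0])
    (fun τ => by
      have h6 := (((hasDerivAt_id τ).sub (((hasDerivAt_id τ).pow 2).div_const 2)).const_mul
        (M * ‖d‖))
      refine h6.congr_deriv ?_
      simp)
    (fun τ hτ => by
      rw [← sub_apply]
      refine (ContinuousLinearMap.le_opNorm _ _).trans ?_
      have h7 := mul_le_mul_of_nonneg_right (hlip τ ⟨hτ.1, hτ.2.le⟩) (norm_nonneg d)
      linarith)
    (right_mem_Icc.2 zero_le_one)
  rw [h1] at key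
  linarith
theorem isProx_prox {J : X → EReal} {H : X →L[𝕜] X} {z : X} (h : ∃ p, IsProx J H z p) :
    IsProx J H z (prox J H z) := by
  rw [prox, dif_pos h]
  exact h.choose_spec

/-! ### Perturbation and scalar estimates. -/

/-- A lower bound for an injective operator is stable under small perturbations. -/
theorem norm_le_of_perturbation {A A' : X →L[𝕜] Y} {β s : ℝ} (hβ : 0 ≤ β)
    (hA : ∀ v, ‖v‖ ≤ β * ‖A v‖) (hs : s < 1) (hAA' : β * ‖A' - A‖ ≤ s) (v : X) :
    ‖v‖ ≤ β / (1 - s) * ‖A' v‖ := by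
  have h1 : ‖A v‖ ≤ ‖A' v‖ + ‖A' - A‖ * ‖v‖ := by
    calc ‖A v‖ = ‖A' v - (A' - A) v‖ := by rw [sub_apply, sub_sub_cancel]
      _ ≤ _ := (norm_sub_le _ _).trans (by gcongr; exact (A' - A).le_opNorm v)
  have h2 := mul_le_mul_of_nonneg_left h1 hβ
  have h3 := mul_le_mul_of_nonneg_right hAA' (norm_nonneg v)
  rw [div_mul_eq_mul_div, le_div_iff₀ (by linarith)]
  linarith [hA v]

/-- The radius of convergence makes the error bound a strict contraction. -/
theorem contraction_of_lt_radius {b h L t : ℝ} (hb : 5 ≤ b) (h0 : 0 ≤ h)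
    (hL : 0 < L) (ht : t < (b - Real.sqrt (b ^ 2 - 8 * (1 - h))) / (2 * L)) :
    L * t < 1 ∧ (b - 4 + L * t) * (L * t) + 2 * h < 2 * (1 - L * t) ^ 2 := by
  rw [lt_div_iff₀ (by positivity)] at ht
  have h2 : 0 ≤ b ^ 2 - 8 * (1 - h) := by nlinarith
  -- With s = Lt, the second claim rearranges to s² - bs + 2(1 - h) > 0, and the hypothesis puts s
  -- below the smaller root. This bound on the square root shows that root to be at most 1.
  have h3 : b - 2 ≤ Real.sqrt (b ^ 2 - 8 * (1 - h)) := Real.le_sqrt_of_sq_le (by nlinarith)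
  have h4 := Real.sq_sqrt h2
  refine ⟨by linarith, ?_⟩
  have h5 : Real.sqrt (b ^ 2 - 8 * (1 - h)) ^ 2 < (b - 2 * (L * t)) ^ 2 := by
    refine pow_lt_pow_left₀ (by linarith) (Real.sqrt_nonneg _) two_ne_zero
  nlinarith

/-- The sharp one-step bound is dominated by the bound with `κ` and `√2`. -/
theorem step_bound_le {κ c β L ρ ρ₀ w : ℝ} (hκ : 1 ≤ κ) (hc : 0 ≤ c) (hβ : 0 ≤ β) (hL : 0 < L)
    (hw : 0 ≤ w) (hρ : 0 ≤ ρ) (hρρ₀ : ρ ≤ ρ₀) (hρ₀ : L * ρ₀ < 1) :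
    L * ρ ^ 2 / (2 * (1 - L * ρ)) + c * β * L * ρ / (1 - L * ρ) ^ 2 ≤
      (κ * L + 2 * c * (1 + w) * β * L ^ 2 + L ^ 2 * ρ₀) / (2 * (1 - L * ρ₀) ^ 2) * ρ ^ 2
        + ((1 + w) * κ + 1) * c * β * L / (1 - L * ρ₀) ^ 2 * ρ := by
  have h0 : 0 ≤ ρ₀ := hρ.trans hρρ₀
  have hle : 1 - L * ρ₀ ≤ 1 - L * ρ := by
    have := mul_le_mul_of_nonneg_left hρρ₀ hL.le
    linarith
  have hpos : 0 < 1 - L * ρ₀ := by linarith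
  have hsq : (1 - L * ρ₀) ^ 2 ≤ 1 - L * ρ := by
    refine le_trans ?_ hle
    nlinarith [mul_nonneg hL.le h0]
  have h1 : L * ρ ^ 2 / (2 * (1 - L * ρ)) ≤
      (κ * L + 2 * c * (1 + w) * β * L ^ 2 + L ^ 2 * ρ₀) / (2 * (1 - L * ρ₀) ^ 2) * ρ ^ 2 := by
    rw [div_mul_eq_mul_div]
    gcongr
    have h3 : 0 ≤ 2 * c * (1 + w) * β * L ^ 2 + L ^ 2 * ρ₀ := by positivity
    nlinarith
  have h2 : c * β * L * ρ / (1 - L * ρ) ^ 2 ≤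
      ((1 + w) * κ + 1) * c * β * L / (1 - L * ρ₀) ^ 2 * ρ := by
    rw [div_mul_eq_mul_div]
    gcongr
    have h3 : 0 ≤ (1 + w) * κ := by positivity
    have h4 : 0 ≤ c * β * L := by positivity
    nlinarith
  exact add_le_add h1 h2

theorem ball_sSup_subset {E : Type*} [PseudoMetricSpace E] (Ω : Set E) (xs : E) {R : ℝ} (hR : 0 < R) :
    Metric.ball xs (sSup {t : ℝ | t ∈ Set.Ico 0 R ∧ Metric.ball xs t ⊆ Ω}) ⊆ Ω := by
  intro y hy
  obtain ⟨t, ht, hlt⟩ := exists_lt_of_lt_csSup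
    (show {t : ℝ | t ∈ Set.Ico 0 R ∧ Metric.ball xs t ⊆ Ω}.Nonempty from
      ⟨0, ⟨le_rfl, hR⟩, by simp⟩) (Metric.mem_ball.1 hy)
  exact ht.2 (Metric.mem_ball.2 hlt)

end ProxGN

/-! ### One step of the method. -/

namespace ProxGN

variable {𝕜 : Type*} [RCLike 𝕜]
  {X : Type*} [NormedAddCommGroup X] [InnerProductSpace 𝕜 X] [CompleteSpace X]
  {Y : Type*} [NormedAddCommGroup Y] [InnerProductSpace 𝕜 Y] [CompleteSpace Y]

theorem isMetricOperator_adjoint_comp_self {A : X →L[𝕜] Y} {K : ℝ} (hK0 : 0 < K)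
    (hK : ∀ v, ‖v‖ ≤ K * ‖A v‖) : IsMetricOperator (ContinuousLinearMap.adjoint A ∘L A) := by
  refine ⟨ContinuousLinearMap.isPositive_adjoint_comp_self A, (K ^ 2)⁻¹, by positivity, fun v => ?_⟩
  rw [ContinuousLinearMap.comp_apply, ContinuousLinearMap.adjoint_inner_right,
    inner_self_eq_norm_sq, inv_mul_le_iff₀ (by positivity), ← mul_pow]
  gcongr
  exact hK v

/-- One step of the proximal Gauss-Newton method near a stationary point. -/
theorem proxGaussNewton_step {Ω : Set X} (hΩ : IsOpen Ω) {J : X → EReal} (hbot : ∀ x, J x ≠ ⊥)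
    (hJ : IsConvexFunctional 𝕜 J) (hlsc : LowerSemicontinuousOn J Ω) {F : X → Y}
    (hF : ContDiffOn 𝕜 1 F Ω) (hclo : ∀ x ∈ Ω, IsClosed (Set.range (fderiv 𝕜 F x)))
    {xs : X} {β L ε : ℝ} (hβ : 0 < β) (hL : 0 < L) (hβF : ∀ v, ‖v‖ ≤ β * ‖fderiv 𝕜 F xs v‖)
    (hstat : -(ContinuousLinearMap.adjoint (fderiv 𝕜 F xs) (F xs)) ∈ subdiff 𝕜 J xs) {x : X}
    (hseg : ∀ τ ∈ Icc (0 : ℝ) 1, xs + (τ : 𝕜) • (x - xs) ∈ Ω)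
    (hLip : ∀ τ ∈ Icc (0 : ℝ) 1,
      β * ‖fderiv 𝕜 F x - fderiv 𝕜 F (xs + (τ : 𝕜) • (x - xs))‖ ≤ L * (1 - τ) * ‖x - xs‖)
    (hρ : L * ‖x - xs‖ < 1)
    (hε : ε = L * ‖x - xs‖ ^ 2 / (2 * (1 - L * ‖x - xs‖))
      + ‖F xs‖ * β * L * ‖x - xs‖ / (1 - L * ‖x - xs‖) ^ 2)
    (hball : ∀ p, ‖p - xs‖ ≤ ε → p ∈ Ω) :
    StepWellDefined 𝕜 F J Ω x ∧ ‖prox J (gnMetric 𝕜 F x) (gnPoint 𝕜 F x) - xs‖ ≤ ε := by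
  have hx : x ∈ Ω := by simpa using hseg 1 (right_mem_Icc.2 zero_le_one)
  have hdiff : ∀ y ∈ Ω, DifferentiableAt 𝕜 F y := fun y hy =>
    (hF.differentiableOn one_ne_zero).differentiableAt (hΩ.mem_nhds hy)
  set ρ := ‖x - xs‖ with hρdef
  set A := fderiv 𝕜 F x with hA
  set As := fderiv 𝕜 F xs with hAs
  have hρ0 : 0 ≤ ρ := norm_nonneg _
  have hpos : 0 < 1 - L * ρ := by linarith
  have hAAs : β * ‖A - As‖ ≤ L * ρ := by simpa using hLip 0 (left_mem_Icc.2 zero_le_one)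
  have hK := norm_le_of_perturbation hβ.le hβF hρ hAAs
  set K := β / (1 - L * ρ) with hKdef
  have hK0 : 0 < K := by positivity
  have hinj : Function.Injective A := by
    refine (injective_iff_map_eq_zero A).2 fun v hv => ?_
    have h1 := hK v
    rw [hv, norm_zero, mul_zero] at h1
    exact norm_le_zero_iff.1 h1
  have hex := exists_isMoorePenrose A hinj (hclo x hx)
  have hmp := pinv_isMoorePenrose hex
  have hmetric : IsMetricOperator (gnMetric 𝕜 F x) := isMetricOperator_adjoint_comp_self hK0 hK
  obtain ⟨p, hp1, hp2⟩ := exists_generalized_prox hJ hbot hK hstat (gnPoint 𝕜 F x)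
  have htaylor : ‖A (x - xs) - F x + F xs‖ ≤ L * ρ / β / 2 * ρ := by
    refine norm_taylor_le (fun τ hτ => hdiff _ (hseg τ hτ)) fun τ hτ => ?_
    rw [div_mul_eq_mul_div, le_div_iff₀ hβ]
    linarith [hLip τ hτ]
  have hsq : ‖A (p - xs)‖ ^ 2 ≤ L * ρ / β / 2 * ρ * ‖A (p - xs)‖
      + ‖F xs‖ * (L * ρ / β * (K * ‖A (p - xs)‖)) := by
    have h1 : RCLike.re (inner 𝕜 (A (gnPoint 𝕜 F x - xs)) (A (p - xs))) =
        RCLike.re (inner 𝕜 (A (x - xs) - F x) (A (p - xs))) := by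
      congr 1
      -- With A moved to the left factor as A^*, the identity A^*AA^†F(x) = A^*F(x) applies.
      rw [← ContinuousLinearMap.adjoint_inner_left, ← ContinuousLinearMap.adjoint_inner_left]
      congr 1
      rw [gnPoint, sub_right_comm, map_sub A, map_sub (ContinuousLinearMap.adjoint A),
        map_sub (ContinuousLinearMap.adjoint A), hmp.adjoint_apply_apply]
    have h2 : RCLike.re (inner 𝕜 (-(ContinuousLinearMap.adjoint As (F xs))) (p - xs)) =
        -RCLike.re (inner 𝕜 (F xs) (As (p - xs))) := by
      rw [inner_neg_left, ContinuousLinearMap.adjoint_inner_left, map_neg]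
    have h3 : RCLike.re (inner 𝕜 (A (x - xs) - F x) (A (p - xs)))
          + RCLike.re (inner 𝕜 (F xs) (As (p - xs)))
        = RCLike.re (inner 𝕜 (A (x - xs) - F x + F xs) (A (p - xs)))
          - RCLike.re (inner 𝕜 (F xs) ((A - As) (p - xs))) := by
      rw [inner_add_left, sub_apply, inner_sub_right, map_add (RCLike.re (K := 𝕜)),
        map_sub (RCLike.re (K := 𝕜))]
      ring
    have h4 := (RCLike.re_le_norm _).trans
      (norm_inner_le_norm (𝕜 := 𝕜) (A (x - xs) - F x + F xs) (A (p - xs)))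
    have h5 := (abs_le.1 ((RCLike.abs_re_le_norm _).trans
      (norm_inner_le_norm (𝕜 := 𝕜) (F xs) ((A - As) (p - xs))))).1
    have h6 : ‖(A - As) (p - xs)‖ ≤ L * ρ / β * (K * ‖A (p - xs)‖) := by
      refine ((A - As).le_opNorm _).trans ?_
      have : ‖A - As‖ ≤ L * ρ / β := by rw [le_div_iff₀ hβ]; linarith
      gcongr
      exact hK _
    have h7 := mul_le_mul_of_nonneg_left h6 (norm_nonneg (F xs))
    have h8 := mul_le_mul_of_nonneg_right htaylor (norm_nonneg (A (p - xs)))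
    rw [h1, h2] at hp1
    linarith
  have hAp : ‖A (p - xs)‖ ≤ L * ρ / β / 2 * ρ + ‖F xs‖ * (L * ρ / β * K) := by
    rcases (norm_nonneg (A (p - xs))).eq_or_lt with h0 | h0
    · rw [← h0]; positivity
    · refine le_of_mul_le_mul_right ?_ h0
      linarith
  have hpε : ‖p - xs‖ ≤ ε := by
    refine (hK _).trans ((mul_le_mul_of_nonneg_left hAp hK0.le).trans (le_of_eq ?_))
    rw [hε, hKdef]
    field_simp
  -- Only now is p known to lie in Ω, so that semicontinuity within the open set Ω gives it at p in
  -- X.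
  have hprox := hp2 fun y hy =>
    hΩ.nhdsWithin_eq (hball p hpε) ▸ hlsc p (hball p hpε) y hy
  have huniq : ∀ q, IsProx J (gnMetric 𝕜 F x) (gnPoint 𝕜 F x) q → q = p := fun q hq =>
    isProx_unique hJ hbot hinj hstat.1 hq hprox
  refine ⟨⟨hx, hdiff x hx, hinj, hex, hmetric, p, hprox, huniq⟩, ?_⟩
  rwa [huniq _ (isProx_prox ⟨p, hprox⟩)]

end ProxGN

/-! ### Iteration and convergence. -/

theorem theorem4p1 {𝕜 : Type*} [RCLike 𝕜]
    {X : Type*} [NormedAddCommGroup X] [InnerProductSpace 𝕜 X] [CompleteSpace X]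
    {Y : Type*} [NormedAddCommGroup Y] [InnerProductSpace 𝕜 Y] [CompleteSpace Y]
    (Ω : Set X) (hΩ : IsOpen Ω)
    (J : X → EReal) (hJ_proper : ProxGN.IsProper J Ω)
    (hJ_convex : ProxGN.IsConvexFunctional 𝕜 J) (hJ_lsc : LowerSemicontinuousOn J Ω)
    (F : X → Y) (hF : ContDiffOn 𝕜 1 F Ω)
    (hF_closed : ∀ x ∈ Ω, IsClosed (Set.range (fderiv 𝕜 F x)))
    (xs : X) (hxs : xs ∈ Ω) (R : ℝ) (hR : 0 < R)
    (c β κ δ : ℝ)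
    (hc : c = ‖F xs‖)
    (hβ : β = ‖ProxGN.pinv (fderiv 𝕜 F xs)‖)
    (hκ : κ = β * ‖fderiv 𝕜 F xs‖)
    (hδ : δ = sSup {t : ℝ | t ∈ Set.Ico 0 R ∧ Metric.ball xs t ⊆ Ω})
    (hstat : -(ContinuousLinearMap.adjoint (fderiv 𝕜 F xs) (F xs)) ∈ ProxGN.subdiff 𝕜 J xs)
    (hinj : Function.Injective (fderiv 𝕜 F xs))
    (L : ℝ) (hL : 0 < L) (h : ℝ)
    (hh : h = ((1 + Real.sqrt 2) * κ + 1) * c * β * L) (hh_lt : h < 1)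
    (hLip : ∀ x ∈ Metric.ball xs δ, ∀ τ ∈ Set.Icc (0 : ℝ) 1,
      β * ‖fderiv 𝕜 F x - fderiv 𝕜 F (xs + (τ : 𝕜) • (x - xs))‖ ≤ L * (1 - τ) * ‖x - xs‖)
    (r : ℝ)
    (hr : r = min
      ((4 + κ + 2 * c * (1 + Real.sqrt 2) * β * L
          - Real.sqrt ((4 + κ + 2 * c * (1 + Real.sqrt 2) * β * L) ^ 2 - 8 * (1 - h)))
        / (2 * L)) δ)
    (x₀ : X) (hx₀ : x₀ ∈ Metric.ball xs r \ {xs}) :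
    (∀ k, ProxGN.StepWellDefined 𝕜 F J Ω (ProxGN.proxGaussNewton 𝕜 F J x₀ k)) ∧
    (∀ k, ProxGN.proxGaussNewton 𝕜 F J x₀ k ∈ Metric.ball xs r) ∧
    Filter.Tendsto (ProxGN.proxGaussNewton 𝕜 F J x₀) Filter.atTop (nhds xs) ∧
    (∀ k, ‖ProxGN.proxGaussNewton 𝕜 F J x₀ (k + 1) - xs‖ ≤
      (κ * L + 2 * c * (1 + Real.sqrt 2) * β * L ^ 2 + L ^ 2 * ‖x₀ - xs‖)
          / (2 * (1 - L * ‖x₀ - xs‖) ^ 2)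
        * ‖ProxGN.proxGaussNewton 𝕜 F J x₀ k - xs‖ ^ 2
      + ((1 + Real.sqrt 2) * κ + 1) * c * β * L / (1 - L * ‖x₀ - xs‖) ^ 2
        * ‖ProxGN.proxGaussNewton 𝕜 F J x₀ k - xs‖) := by

  have hbot := hJ_proper.1
  have hball := ProxGN.ball_sSup_subset Ω xs hR
  rw [← hδ] at hball
  have hmp := ProxGN.pinv_isMoorePenrose
    (ProxGN.exists_isMoorePenrose (fderiv 𝕜 F xs) hinj (hF_closed xs hxs))
  have hBA := hmp.apply_apply_of_injective hinj
  have hβF : ∀ v, ‖v‖ ≤ β * ‖fderiv 𝕜 F xs v‖ := fun v => by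
    rw [hβ]
    simpa only [hBA] using (ProxGN.pinv (fderiv 𝕜 F xs)).le_opNorm (fderiv 𝕜 F xs v)
  have hx₀r : ‖x₀ - xs‖ < r := mem_ball_iff_norm.1 hx₀.1
  have hρ₀ : 0 < ‖x₀ - xs‖ := norm_pos_iff.2 (sub_ne_zero.2 hx₀.2)
  have hβ0 : 0 ≤ β := hβ ▸ norm_nonneg _
  -- Here x₀ ≠ x_* matters: it provides the nonzero vector without which κ could be 0.
  have hκ1 : 1 ≤ κ := by
    have h1 : ‖x₀ - xs‖ ≤ κ * ‖x₀ - xs‖ := by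
      rw [hκ, mul_assoc]
      exact (hβF _).trans (by gcongr; exact (fderiv 𝕜 F xs).le_opNorm _)
    exact le_of_mul_le_mul_right (by linarith) hρ₀
  have hβpos : 0 < β := hβ0.lt_of_ne fun h0 => by
    rw [← h0, zero_mul] at hκ
    linarith
  have hc0 : 0 ≤ c := hc ▸ norm_nonneg _
  have hw : 0 ≤ Real.sqrt 2 := Real.sqrt_nonneg 2
  have hh0 : 0 ≤ h := by rw [hh]; positivity
  have hrδ : r ≤ δ := hr ▸ min_le_right _ _
  have hb : 5 ≤ 4 + κ + 2 * c * (1 + Real.sqrt 2) * β * L := by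
    have : 0 ≤ 2 * c * (1 + Real.sqrt 2) * β * L := by positivity
    linarith
  obtain ⟨hLρ₀, hcontr⟩ := ProxGN.contraction_of_lt_radius hb hh0 hL
    (hx₀r.trans_le (hr ▸ min_le_left _ _))
  set ρ₀ := ‖x₀ - xs‖ with hρ₀def
  have hpos : 0 < 1 - L * ρ₀ := by linarith
  set C₁ := (κ * L + 2 * c * (1 + Real.sqrt 2) * β * L ^ 2 + L ^ 2 * ρ₀)
    / (2 * (1 - L * ρ₀) ^ 2) with hC₁
  set C₂ := ((1 + Real.sqrt 2) * κ + 1) * c * β * L / (1 - L * ρ₀) ^ 2 with hC₂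
  have hC₁0 : 0 ≤ C₁ := by positivity
  have hC₂0 : 0 ≤ C₂ := by positivity
  -- The contraction factor obtained by bounding one factor ‖x - x_*‖ of the quadratic term by ρ₀.
  set q := C₁ * ρ₀ + C₂ with hq
  have hq0 : 0 ≤ q := by positivity
  have hq1 : q < 1 := by
    have : q = ((4 + κ + 2 * c * (1 + Real.sqrt 2) * β * L - 4 + L * ρ₀) * (L * ρ₀) + 2 * h)
        / (2 * (1 - L * ρ₀) ^ 2) := by
      rw [hq, hC₁, hC₂, hh]
      field_simp
      ring
    rw [this, div_lt_one (by positivity)]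
    exact hcontr
  have hstep : ∀ x, ‖x - xs‖ ≤ ρ₀ → ProxGN.StepWellDefined 𝕜 F J Ω x ∧
      ‖ProxGN.prox J (ProxGN.gnMetric 𝕜 F x) (ProxGN.gnPoint 𝕜 F x) - xs‖
        ≤ C₁ * ‖x - xs‖ ^ 2 + C₂ * ‖x - xs‖ ∧
      C₁ * ‖x - xs‖ ^ 2 + C₂ * ‖x - xs‖ ≤ q * ‖x - xs‖ := by
    intro x hx
    have hxδ : ‖x - xs‖ < δ := hx.trans_lt (hx₀r.trans_le hrδ)
    have hbound := ProxGN.step_bound_le hκ1 hc0 hβ0 hL hw (norm_nonneg (x - xs)) hx hLρ₀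
    rw [← hC₁, ← hC₂] at hbound
    have hqle : C₁ * ‖x - xs‖ ^ 2 + C₂ * ‖x - xs‖ ≤ q * ‖x - xs‖ := by
      have := mul_le_mul_of_nonneg_left hx (mul_nonneg hC₁0 (norm_nonneg (x - xs)))
      rw [hq]
      linarith
    have hle : q * ‖x - xs‖ ≤ ‖x - xs‖ := mul_le_of_le_one_left (norm_nonneg _) hq1.le
    have hmem : ∀ p, ‖p - xs‖ ≤ ‖x - xs‖ → p ∈ Ω := fun p hp =>
      hball (mem_ball_iff_norm.2 (hp.trans_lt hxδ))
    have key := ProxGN.proxGaussNewton_step hΩ hbot hJ_convex hJ_lsc hF hF_closed hβpos hL hβF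
      hstat (x := x)
      (fun τ hτ => hmem _ (by
        rw [add_sub_cancel_left, norm_smul, RCLike.norm_ofReal, abs_of_nonneg hτ.1]
        exact mul_le_of_le_one_left (norm_nonneg _) hτ.2))
      (hLip x (mem_ball_iff_norm.2 hxδ))
      ((mul_le_mul_of_nonneg_left hx hL.le).trans_lt hLρ₀) rfl
      (fun p hp => hmem p (by
        rw [← hc] at hp
        exact hp.trans (hbound.trans (hqle.trans hle))))
    rw [← hc] at key
    exact ⟨key.1, key.2.trans hbound, hqle⟩
  have hnorm : ∀ k, ‖ProxGN.proxGaussNewton 𝕜 F J x₀ k - xs‖ ≤ q ^ k * ρ₀ := by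
    intro k
    induction k with
    | zero => rw [pow_zero, one_mul]; exact le_rfl
    | succ k ih =>
      have h1 : ‖ProxGN.proxGaussNewton 𝕜 F J x₀ k - xs‖ ≤ ρ₀ :=
        ih.trans (mul_le_of_le_one_left hρ₀.le (pow_le_one₀ hq0 hq1.le))
      obtain ⟨-, h2, h3⟩ := hstep _ h1
      refine (h2.trans h3).trans ?_
      rw [pow_succ', mul_assoc]
      exact mul_le_mul_of_nonneg_left ih hq0
  have hle : ∀ k, ‖ProxGN.proxGaussNewton 𝕜 F J x₀ k - xs‖ ≤ ρ₀ := fun k =>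
    (hnorm k).trans (mul_le_of_le_one_left hρ₀.le (pow_le_one₀ hq0 hq1.le))
  refine ⟨fun k => (hstep _ (hle k)).1, fun k => mem_ball_iff_norm.2 ((hle k).trans_lt hx₀r), ?_,
    fun k => (hstep _ (hle k)).2.1⟩
  rw [tendsto_iff_norm_sub_tendsto_zero]
  refine squeeze_zero (fun k => norm_nonneg _) hnorm ?_
  simpa using (tendsto_pow_atTop_nhds_zero_of_lt_one hq0 hq1).mul_const ρ₀
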